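/- Let $n\ge 0$ be an integer, let $S^n$ be the unit sphere of $\mathbb{R}^{n+1}$, and write $|PQ|=\arccos(P\cdot Q)$ for the spherical distance of $P,Q\in S^n$. A set $K\subseteq S^n$ is called a spherical convex body if it is closed, has nonempty interior relative to $S^n$, and the cone $\{\lambda u:\lambda>0,\ u\in K\}$ is convex in $\mathbb{R}^{n+1}$. A spherical convex body $K$ is said to be of constant diameter $\tau$ if $\max\{|PQ|:P,Q\in K\}=\tau$ and for every point $P$ of the boundary $\partial K$ (relative to $S^n$) there exists a point $Q\in K$ with $|PQ|=\tau$. The spherical polar of $C\subseteq S^n$ is $$C^\circ=\bigcap_{P\in C}\{Q\in S^n: P\cdot Q\ge 0\}.$$ Let $C$ be a spherical convex body in $S^n$ and let $0<\tau<\pi$. Then the following are equivalent: 1. $C$ is of constant diameter $\tau$; 2. $C^\circ$ is a spherical convex body of constant diameter $\pi-\tau$. -/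

import Mathlib

namespace SphericalBody

/-- The unit sphere `S^n` of `ℝ^{n+1}`, as a subspace of Euclidean space. Interiors and boundaries
of sets `K : Set (Sph n)` are therefore taken relative to the sphere. -/
abbrev Sph (n : ℕ) : Type :=
  Metric.sphere (0 : EuclideanSpace ℝ (Fin (n + 1))) 1

/-- The spherical distance `|PQ| = arccos (P · Q)`. -/
noncomputable def sdist {n : ℕ} (P Q : Sph n) : ℝ :=
  Real.arccos (inner ℝ (P : EuclideanSpace ℝ (Fin (n + 1))) (Q : EuclideanSpace ℝ (Fin (n + 1))))

/-- The cone `{t u : t > 0, u ∈ K}` in `ℝ^{n+1}`. -/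
def posCone {n : ℕ} (K : Set (Sph n)) : Set (EuclideanSpace ℝ (Fin (n + 1))) :=
  {x | ∃ t : ℝ, 0 < t ∧ ∃ u ∈ K, x = t • (u : EuclideanSpace ℝ (Fin (n + 1)))}

/-- `K` is spherically convex if `{t u : t > 0, u ∈ K}` is convex. -/
def SphericallyConvex {n : ℕ} (K : Set (Sph n)) : Prop :=
  Convex ℝ (posCone K)

/-- A spherical convex body: closed, spherically convex, with nonempty interior relative to the
sphere. -/
structure IsConvexBody {n : ℕ} (K : Set (Sph n)) : Prop where
  isClosed : IsClosed K
  convex : SphericallyConvex K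
  nonempty_interior : (interior K).Nonempty

/-- The closed hemisphere centered at `P`. -/
def hemisphere {n : ℕ} (P : Sph n) : Set (Sph n) :=
  {Q | 0 ≤ inner ℝ (P : EuclideanSpace ℝ (Fin (n + 1))) (Q : EuclideanSpace ℝ (Fin (n + 1)))}

/-- The spherical polar set: the intersection of the closed hemispheres centered at the points
of `W`. -/
def polar {n : ℕ} (W : Set (Sph n)) : Set (Sph n) :=
  ⋂ P ∈ W, hemisphere P

/-- The diameter of `K`, that is `max {|PQ| : P, Q ∈ K}`, exists and equals `d`. -/
def HasDiameter {n : ℕ} (K : Set (Sph n)) (d : ℝ) : Prop :=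
  IsGreatest {r : ℝ | ∃ P ∈ K, ∃ Q ∈ K, r = sdist P Q} d

/-- `K` is a spherical convex body of constant diameter `τ`: its diameter is `τ`, and every
boundary point of `K` has distance `τ` from some point of `K`. -/
structure IsOfConstantDiameter {n : ℕ} (K : Set (Sph n)) (τ : ℝ) : Prop where
  isConvexBody : IsConvexBody K
  hasDiameter : HasDiameter K τ
  exists_sdist_eq : ∀ P ∈ frontier K, ∃ Q ∈ K, sdist P Q = τ

end SphericalBody

open Set Filter Topology RealInnerProductSpace

namespace SphericalBody

variable {n : ℕ} {C : Set (Sph n)}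

local notation "𝔼" n => EuclideanSpace ℝ (Fin (n + 1))

/-! Write `c = cos τ` and `s = sin τ`. The core is `exists_mem_along_normal`: if `X ∈ C`, `Y ∈ polar
C` and `X ⊥ Y`, then `P = cX + sY` lies in `C`. As `X` is then farthest from `P`, the unit tangent
`Z = (X - cP)/s` lies in `polar C` (`exists_mem_polar_of_farthest`), and `Y · Z = -c`: so `Y` has a
partner at distance `π - τ`. Every boundary point `Y` of the polar is orthogonal to some `X ∈ C`. If
the polar had diameter `δ > π - τ`, attained at `Y, Z`, the tangent `X` at `Y` towards `Z` would lie
in `polar (polar C) = C`, and `P · Z = sin (τ + δ) < 0` would contradict `Z ∈ polar C`. The converse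
is the same implication for the polar.

The core itself rests on `exists_smul_mem_convexHull`: perturbing `X` to nearby boundary points
shows that the normal `Y`, up to scale, is a convex combination of directions to diametral points.
Convexity (`c < 0`) or completeness (`c ≥ 0`, `mem_of_forall_le_inner`) then puts `P` in `C`. -/

/-! ### Cones over spherical sets and boundary crossings. -/

theorem norm_coe (P : Sph n) : ‖(P : 𝔼 n)‖ = 1 := norm_eq_of_mem_sphere P

theorem inner_self_coe (P : Sph n) : ⟪(P : 𝔼 n), (P : 𝔼 n)⟫ = 1 := by
  rw [real_inner_self_eq_norm_sq, norm_coe]; norm_num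

theorem coe_ne_zero (P : Sph n) : (P : 𝔼 n) ≠ 0 := by
  intro h
  have := norm_coe P
  simp [h] at this

/-- The radial projection of a nonzero vector to the unit sphere. -/
noncomputable def normalize (v : 𝔼 n) (hv : v ≠ 0) : Sph n :=
  ⟨‖v‖⁻¹ • v, by simp [norm_smul, hv]⟩

theorem norm_smul_normalize (v : 𝔼 n) (hv : v ≠ 0) : ‖v‖ • (normalize v hv : 𝔼 n) = v := by
  simp [normalize, smul_smul, hv]

theorem smul_coe_injective {r s : ℝ} (hr : 0 < r) (hs : 0 ≤ s) {P Q : Sph n}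
    (h : r • (P : 𝔼 n) = s • (Q : 𝔼 n)) : P = Q := by
  have h1 : r = s := by
    have := congrArg norm h
    simpa [norm_smul, norm_coe, abs_of_pos hr, abs_of_nonneg hs] using this
  subst h1
  exact Subtype.ext (smul_right_injective _ hr.ne' h)

theorem coe_mem_posCone {P : Sph n} : (P : 𝔼 n) ∈ posCone C ↔ P ∈ C := by
  constructor
  · rintro ⟨t, ht, u, hu, h⟩
    have : P = u := smul_coe_injective one_pos ht.le (by simpa using h)
    exact this ▸ hu
  · intro h
    exact ⟨1, one_pos, P, h, by simp⟩

theorem smul_mem_posCone {r : ℝ} (hr : 0 < r) {v : 𝔼 n} (hv : v ∈ posCone C) :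
    r • v ∈ posCone C := by
  obtain ⟨t, ht, u, hu, rfl⟩ := hv
  exact ⟨r * t, mul_pos hr ht, u, hu, by rw [smul_smul]⟩

theorem ne_zero_of_mem_posCone {v : 𝔼 n} (hv : v ∈ posCone C) : v ≠ 0 := by
  obtain ⟨t, ht, u, hu, rfl⟩ := hv
  exact smul_ne_zero ht.ne' (coe_ne_zero u)

theorem mem_posCone_iff {v : 𝔼 n} (hv : v ≠ 0) : v ∈ posCone C ↔ normalize v hv ∈ C := by
  rw [← coe_mem_posCone]
  constructor
  · intro h
    exact smul_mem_posCone (inv_pos.2 (norm_pos_iff.2 hv)) h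
  · intro h
    rw [← norm_smul_normalize v hv]
    exact smul_mem_posCone (norm_pos_iff.2 hv) h

theorem mem_polar {Y : Sph n} : Y ∈ polar C ↔ ∀ P ∈ C, 0 ≤ ⟪(P : 𝔼 n), (Y : 𝔼 n)⟫ := by
  simp [polar, hemisphere]

theorem inner_nonneg_of_mem_posCone {v : 𝔼 n} (hv : v ∈ posCone C) {Y : Sph n}
    (hY : Y ∈ polar C) : 0 ≤ ⟪v, (Y : 𝔼 n)⟫ := by
  obtain ⟨t, ht, u, hu, rfl⟩ := hv
  rw [real_inner_smul_left]
  exact mul_nonneg ht.le (mem_polar.1 hY u hu)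

theorem posCone_mem_nhds {I : Sph n} (hI : I ∈ interior C) : posCone C ∈ 𝓝 (I : 𝔼 n) := by
  obtain ⟨U, hU, hUC⟩ := isOpen_induced_iff.1 (isOpen_interior (s := C))
  have hc : ContinuousAt (fun v : 𝔼 n => ‖v‖⁻¹ • v) (I : 𝔼 n) :=
    (continuousAt_id.norm.inv₀ (by simp)).smul continuousAt_id
  have hIU : ‖(I : 𝔼 n)‖⁻¹ • (I : 𝔼 n) ∈ U := by
    have : I ∈ Subtype.val ⁻¹' U := hUC ▸ hI
    simpa using this
  filter_upwards [hc.preimage_mem_nhds (hU.mem_nhds hIU), isOpen_ne.mem_nhds (coe_ne_zero I)]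
    with v hv hv0
  refine (mem_posCone_iff hv0).2 (interior_subset ?_)
  rw [← hUC]
  exact hv

/-- For small `ε > 0` the vector `I - εY` is still in the cone, so `0 ≤ I · Y - ε`. -/
theorem inner_pos_of_mem_interior {I : Sph n} (hI : I ∈ interior C) {Y : Sph n}
    (hY : Y ∈ polar C) : 0 < ⟪(I : 𝔼 n), (Y : 𝔼 n)⟫ := by
  have hc : ContinuousAt (fun ε : ℝ => (I : 𝔼 n) - ε • (Y : 𝔼 n)) 0 := by fun_prop
  have h := hc.preimage_mem_nhds (t := posCone C) (by simpa using posCone_mem_nhds hI)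
  have h' : ∀ᶠ ε in 𝓝[>] (0 : ℝ), (I : 𝔼 n) - ε • (Y : 𝔼 n) ∈ posCone C := nhdsWithin_le_nhds h
  obtain ⟨ε, hε, hm⟩ := (h'.and self_mem_nhdsWithin).exists
  have := inner_nonneg_of_mem_posCone hε hY
  rw [inner_sub_left, real_inner_smul_left, inner_self_coe] at this
  have : 0 < ε := hm
  linarith

/-- A segment that avoids the origin and joins a point of the cone over a closed set to a point
outside the cone passes over a boundary point. -/
theorem exists_frontier_on_segment {a b : 𝔼 n}
    (h0 : ∀ s ∈ Icc (0 : ℝ) 1, a + s • (b - a) ≠ 0) (ha : a ∈ posCone C) (hb : b ∉ posCone C) :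
    ∃ s ∈ Icc (0 : ℝ) 1, ∃ B ∈ frontier C,
      a + s • (b - a) = ‖a + s • (b - a)‖ • (B : 𝔼 n) := by
  let γ : Icc (0 : ℝ) 1 → Sph n := fun s => normalize (a + (s : ℝ) • (b - a)) (h0 s s.2)
  have hγ : Continuous γ := by
    refine Continuous.subtype_mk ?_ _
    have hv : Continuous fun s : Icc (0 : ℝ) 1 => a + (s : ℝ) • (b - a) := by fun_prop
    exact (hv.norm.inv₀ fun s => norm_ne_zero_iff.2 (h0 s s.2)).smul hv
  have hne : (frontier (γ ⁻¹' C)).Nonempty := by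
    rw [nonempty_frontier_iff]
    refine ⟨⟨⟨0, by simp⟩, ?_⟩, ?_⟩
    · change normalize _ _ ∈ C
      rw [← mem_posCone_iff]
      simpa using ha
    · intro hu
      have h1 : (⟨1, by simp⟩ : Icc (0 : ℝ) 1) ∈ γ ⁻¹' C := hu ▸ mem_univ _
      have h2 : normalize _ _ ∈ C := h1
      rw [← mem_posCone_iff] at h2
      exact hb (by simpa using h2)
  obtain ⟨s, hs⟩ := hne
  exact ⟨s, s.2, γ s, hγ.frontier_preimage_subset C hs, (norm_smul_normalize _ _).symm⟩

/-! ### Compact convex hulls and separation. -/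

/-- By Carathéodory, the hull is a continuous image of a simplex times a power of `s`. -/
theorem isCompact_convexHull {F : Type*} [NormedAddCommGroup F] [NormedSpace ℝ F]
    [FiniteDimensional ℝ F] {s : Set F} (hs : IsCompact s) : IsCompact (convexHull ℝ s) := by
  rcases s.eq_empty_or_nonempty with rfl | ⟨p, hp⟩
  · simp
  let N := Module.finrank ℝ F + 1
  let f : (Fin N → ℝ) × (Fin N → F) → F := fun q => ∑ i, q.1 i • q.2 i
  have hf : Continuous f := by fun_prop
  have hK : IsCompact (stdSimplex ℝ (Fin N) ×ˢ Set.pi univ fun _ : Fin N => s) :=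
    (isCompact_stdSimplex ℝ _).prod (isCompact_univ_pi fun _ => hs)
  convert hK.image hf using 1
  ext x
  constructor
  · intro hx
    obtain ⟨ι, _, z, w, hz, hind, hw, hsum, rfl⟩ := eq_pos_convex_span_of_mem_convexHull hx
    have hcard : Fintype.card ι ≤ Fintype.card (Fin N) := by
      rw [Fintype.card_fin]
      exact hind.card_le_finrank_succ.trans (Nat.succ_le_succ (Submodule.finrank_le _))
    obtain ⟨e⟩ := Function.Embedding.nonempty_of_card_le hcard
    -- Unused slots get weight `0` and the dummy point `p ∈ s`.
    refine ⟨(Function.extend e w 0, Function.extend e z fun _ => p), ⟨⟨?_, ?_⟩, ?_⟩, ?_⟩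
    · intro j
      by_cases hj : ∃ i, e i = j
      · obtain ⟨i, rfl⟩ := hj
        simpa [e.injective.extend_apply] using (hw i).le
      · simp [Function.extend_apply' _ _ _ hj]
    · rw [← hsum]
      refine (Fintype.sum_of_injective e e.injective _ _ ?_ ?_).symm
      · intro j hj
        exact Function.extend_apply' _ _ _ hj
      · intro i
        exact (e.injective.extend_apply _ _ _).symm
    · intro j _
      by_cases hj : ∃ i, e i = j
      · obtain ⟨i, rfl⟩ := hj
        simpa [e.injective.extend_apply] using hz (mem_range_self i)
      · simpa [Function.extend_apply' _ _ _ hj] using hp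
    · refine (Fintype.sum_of_injective e e.injective _ _ ?_ ?_).symm
      · intro j hj
        have hj' : ¬ ∃ i, e i = j := hj
        simp [Function.extend_apply' _ _ _ hj']
      · intro i
        simp [e.injective.extend_apply]
  · rintro ⟨⟨w, z⟩, ⟨⟨hw, hsum⟩, hz⟩, rfl⟩
    exact (convex_convexHull ℝ s).sum_mem (fun i _ => hw i) hsum
      fun i hi => subset_convexHull ℝ s (hz i (mem_univ i))

/-- Separation of a compact set from a ray disjoint from its convex hull. -/
theorem exists_inner_neg_of_ray_disjoint {D : Set (𝔼 n)} (hD : IsCompact D) {Y : 𝔼 n}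
    (h : ∀ t : ℝ, 0 ≤ t → t • Y ∉ convexHull ℝ D) :
    ∃ V : 𝔼 n, (∀ d ∈ D, ⟪V, d⟫ < 0) ∧ (Y ≠ 0 → 0 < ⟪V, Y⟫) := by
  have hray : IsClosed ((fun t : ℝ => t • Y) '' Ici 0) := by
    rcases eq_or_ne Y 0 with rfl | hY
    · have : ((fun t : ℝ => t • (0 : 𝔼 n)) '' Ici 0) = {0} := by
        ext x
        simp only [smul_zero, mem_image, mem_Ici, mem_singleton_iff]
        exact ⟨fun ⟨_, _, h⟩ => h.symm, fun h => ⟨0, le_rfl, h.symm⟩⟩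
      rw [this]
      exact isClosed_singleton
    · exact (isClosedEmbedding_smul_left hY).isClosedMap _ isClosed_Ici
  have hconv : Convex ℝ ((fun t : ℝ => t • Y) '' Ici 0) :=
    (convex_Ici 0).linear_image ((LinearMap.id (R := ℝ) (M := ℝ)).smulRight Y)
  obtain ⟨f, u, v, hu, huv, hv⟩ := geometric_hahn_banach_compact_closed (convex_convexHull ℝ D)
    (isCompact_convexHull hD) hconv hray (by
      rw [Set.disjoint_left]
      rintro x hx ⟨t, ht, rfl⟩
      exact h t ht hx)
  have hv0 : v < 0 := by simpa using hv 0 ⟨0, by simp, by simp⟩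
  have hfY : 0 ≤ f Y := by
    by_contra! hneg
    have := hv ((v / f Y) • Y) ⟨_, div_nonneg_of_nonpos hv0.le hneg.le, rfl⟩
    rw [map_smul, smul_eq_mul, div_mul_cancel₀ _ hneg.ne] at this
    exact lt_irrefl _ this
  obtain ⟨M, hM⟩ := hD.isBounded.exists_norm_le
  -- The functional `f` may vanish at `Y`, so it is tilted by `δY`, with `δ` small enough that `δ⟪Y,
  -- d⟫ ≤ -u` on `D`.
  have hM0 : 0 < |M| + 1 := by positivity
  have hYn : 0 < ‖Y‖ + 1 := by positivity
  set δ : ℝ := -u / ((|M| + 1) * (‖Y‖ + 1)) with hδ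
  have hδ0 : 0 < δ := div_pos (by linarith) (by positivity)
  refine ⟨(InnerProductSpace.toDual ℝ (𝔼 n)).symm f + δ • Y, ?_, ?_⟩
  · intro d hd
    rw [inner_add_left, InnerProductSpace.toDual_symm_apply, real_inner_smul_left]
    have h1 := hu d (subset_convexHull ℝ D hd)
    have h2 : ⟪Y, d⟫ ≤ (|M| + 1) * (‖Y‖ + 1) := by
      calc ⟪Y, d⟫ ≤ ‖Y‖ * ‖d‖ := real_inner_le_norm _ _
        _ ≤ (‖Y‖ + 1) * (|M| + 1) := by
          gcongr
          · linarith
          · linarith [hM d hd, le_abs_self M]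
        _ = _ := mul_comm _ _
    have h3 : δ * ⟪Y, d⟫ ≤ -u := by
      calc δ * ⟪Y, d⟫ ≤ δ * ((|M| + 1) * (‖Y‖ + 1)) := by gcongr
        _ = -u := by rw [hδ]; field_simp
    linarith
  · intro hY
    rw [inner_add_left, InnerProductSpace.toDual_symm_apply, real_inner_smul_left]
    have : 0 < ⟪Y, Y⟫ := real_inner_self_pos.2 hY
    have := mul_pos hδ0 this
    linarith

theorem convexHull_coe_subset_posCone (hC : SphericallyConvex C) :
    convexHull ℝ ((fun P : Sph n => (P : 𝔼 n)) '' C) ⊆ posCone C := by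
  refine convexHull_min ?_ hC
  rintro _ ⟨P, hP, rfl⟩
  exact coe_mem_posCone.2 hP

theorem isCompact_image_coe (hC : IsClosed C) :
    IsCompact ((fun P : Sph n => (P : 𝔼 n)) '' C) :=
  hC.isCompact.image continuous_subtype_val

/-! ### Polar duality of convex bodies. -/

/-- Strict positivity on a compact set survives small changes of `Y`. -/
theorem mem_interior_polar (hC : IsClosed C) {Y : Sph n}
    (h : ∀ P ∈ C, 0 < ⟪(P : 𝔼 n), (Y : 𝔼 n)⟫) : Y ∈ interior (polar C) := by
  rw [mem_interior_iff_mem_nhds]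
  have hc : Continuous fun q : Sph n × Sph n => ⟪(q.2 : 𝔼 n), (q.1 : 𝔼 n)⟫ := by fun_prop
  have h2 := hC.isCompact.eventually_forall_of_forall_eventually (x₀ := Y)
    (P := fun Z P => 0 < ⟪(P : 𝔼 n), (Z : 𝔼 n)⟫) fun P hP =>
      (hc.tendsto (Y, P)).eventually_const_lt (h P hP)
  filter_upwards [h2] with Z hZ
  exact mem_polar.2 fun P hP => (hZ P hP).le

theorem exists_inner_eq_zero_of_mem_frontier_polar (hC : IsClosed C) {Y : Sph n}
    (hY : Y ∈ frontier (polar C)) (hYC : Y ∈ polar C) :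
    ∃ X ∈ C, ⟪(X : 𝔼 n), (Y : 𝔼 n)⟫ = 0 := by
  by_contra! hne
  exact hY.2 (mem_interior_polar hC fun P hP => (mem_polar.1 hYC P hP).lt_of_ne' (hne P hP))

theorem isClosed_polar : IsClosed (polar C) := by
  refine isClosed_biInter fun P _ => ?_
  exact isClosed_le continuous_const (by fun_prop)

theorem IsConvexBody.polar (hC : IsConvexBody C) : IsConvexBody (polar C) := by
  obtain ⟨I, hI⟩ := hC.nonempty_interior
  refine ⟨isClosed_polar, ?_, ?_⟩
  · intro x hx y hy a b ha hb hab
    have hpos : ∀ z ∈ posCone (SphericalBody.polar C), 0 < ⟪(I : 𝔼 n), z⟫ := by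
      rintro _ ⟨t, ht, u, hu, rfl⟩
      rw [real_inner_smul_right]
      exact mul_pos ht (inner_pos_of_mem_interior hI hu)
    have hnn : ∀ z ∈ posCone (SphericalBody.polar C), ∀ P ∈ C, 0 ≤ ⟪(P : 𝔼 n), z⟫ := by
      rintro _ ⟨t, ht, u, hu, rfl⟩ P hP
      rw [real_inner_smul_right]
      exact mul_nonneg ht.le (mem_polar.1 hu P hP)
    have h0 : a • x + b • y ≠ 0 := by
      intro h
      have h1 : ⟪(I : 𝔼 n), a • x + b • y⟫ = 0 := by rw [h, inner_zero_right]
      rw [inner_add_right, real_inner_smul_right, real_inner_smul_right] at h1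
      have hx' := hpos x hx
      have hy' := hpos y hy
      rcases ha.eq_or_lt with rfl | ha
      · simp only [zero_add] at hab
        subst hab
        linarith
      · have := mul_pos ha hx'
        have := mul_nonneg hb hy'.le
        linarith
    rw [mem_posCone_iff h0, mem_polar]
    intro P hP
    change 0 ≤ ⟪(P : 𝔼 n), ‖a • x + b • y‖⁻¹ • (a • x + b • y)⟫
    rw [real_inner_smul_right, inner_add_right, real_inner_smul_right, real_inner_smul_right]
    have := hnn x hx P hP
    have := hnn y hy P hP
    positivity
  -- With `Y = 0` the ray is the origin, which the cone over `C` omits; `-V` is then strictly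
  -- positive on `C`.
  · obtain ⟨V, hV, -⟩ := exists_inner_neg_of_ray_disjoint (isCompact_image_coe hC.isClosed)
      (Y := 0) (fun t _ h => ne_zero_of_mem_posCone (convexHull_coe_subset_posCone hC.convex h)
        (smul_zero t))
    have hV0 : -V ≠ 0 := by
      intro h
      have := hV I ⟨I, interior_subset hI, rfl⟩
      rw [neg_eq_zero.1 h, inner_zero_left] at this
      exact lt_irrefl _ this
    refine ⟨normalize (-V) hV0, mem_interior_polar hC.isClosed fun P hP => ?_⟩
    change 0 < ⟪(P : 𝔼 n), ‖-V‖⁻¹ • -V⟫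
    rw [real_inner_smul_right, inner_neg_right, real_inner_comm]
    have := hV P ⟨P, hP, rfl⟩
    exact mul_pos (inv_pos.2 (norm_pos_iff.2 hV0)) (by linarith)

theorem polar_polar (hC : IsConvexBody C) : polar (polar C) = C := by
  apply Subset.antisymm
  · intro X hX
    by_contra hXC
    obtain ⟨V, hV, hVX⟩ := exists_inner_neg_of_ray_disjoint (isCompact_image_coe hC.isClosed)
      (Y := (X : 𝔼 n)) (by
        intro t ht h
        obtain ⟨r, hr, u, hu, h⟩ := convexHull_coe_subset_posCone hC.convex h
        exact hXC (smul_coe_injective hr ht h.symm ▸ hu))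
    have hVX := hVX (coe_ne_zero X)
    have hV0 : -V ≠ 0 := by
      intro h
      rw [neg_eq_zero.1 h, inner_zero_left] at hVX
      exact lt_irrefl _ hVX
    have hn : 0 < ‖-V‖⁻¹ := inv_pos.2 (norm_pos_iff.2 hV0)
    have hmem : normalize (-V) hV0 ∈ polar C := by
      refine mem_polar.2 fun P hP => ?_
      change 0 ≤ ⟪(P : 𝔼 n), ‖-V‖⁻¹ • -V⟫
      rw [real_inner_smul_right, inner_neg_right, real_inner_comm]
      have := hV P ⟨P, hP, rfl⟩
      exact mul_nonneg hn.le (by linarith)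
    have h1 : 0 ≤ ⟪‖-V‖⁻¹ • -V, (X : 𝔼 n)⟫ := mem_polar.1 hX _ hmem
    rw [real_inner_smul_left, inner_neg_left] at h1
    have := mul_pos hn hVX
    linarith
  · intro P hP
    refine mem_polar.2 fun Y hY => ?_
    rw [real_inner_comm]
    exact mem_polar.1 hY P hP

/-! ### Farthest points and their tangents. -/

/-- If `Q` is a point of `C` farthest from `P ∈ C`, then the unit tangent at `Q` pointing
towards `P` lies in the polar of `C`. -/
theorem exists_mem_polar_of_farthest (hC : SphericallyConvex C) {P Q : Sph n} (hQ : Q ∈ C)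
    {c s : ℝ} (hs : 0 < s) (hcs : c ^ 2 + s ^ 2 = 1) (hPQ : ⟪(P : 𝔼 n), (Q : 𝔼 n)⟫ = c)
    (hmin : ∀ X ∈ C, c ≤ ⟪(P : 𝔼 n), (X : 𝔼 n)⟫) :
    ∃ Y ∈ polar C, (Y : 𝔼 n) = s⁻¹ • ((P : 𝔼 n) - c • (Q : 𝔼 n)) := by
  have hnorm : ‖s⁻¹ • ((P : 𝔼 n) - c • (Q : 𝔼 n))‖ = 1 := by
    have h1 : ‖(P : 𝔼 n) - c • (Q : 𝔼 n)‖ ^ 2 = s ^ 2 := by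
      rw [norm_sub_sq_real, real_inner_smul_right, hPQ, norm_smul, norm_coe, norm_coe,
        Real.norm_eq_abs, mul_one, sq_abs]
      linarith
    rw [norm_smul, (sq_eq_sq₀ (norm_nonneg _) hs.le).1 h1, norm_inv, Real.norm_of_nonneg hs.le,
      inv_mul_cancel₀ hs.ne']
  refine ⟨⟨_, by simpa using hnorm⟩, mem_polar.2 fun X hX => ?_, rfl⟩
  change 0 ≤ ⟪(X : 𝔼 n), s⁻¹ • ((P : 𝔼 n) - c • (Q : 𝔼 n))⟫
  rw [real_inner_smul_right, inner_sub_right, real_inner_smul_right]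
  refine mul_nonneg (inv_pos.2 hs).le ?_
  -- First variation at `Q` along the segment to `X`: dividing by `ε` and letting `ε → 0` yields `c
  -- (Q · X) ≤ P · X`.
  have hseg : ∀ ε ∈ Ioo (0 : ℝ) 1,
      c * ‖(1 - ε) • (Q : 𝔼 n) + ε • (X : 𝔼 n)‖ ≤ (1 - ε) * c + ε * ⟪(P : 𝔼 n), (X : 𝔼 n)⟫ := by
    intro ε hε
    have hm : (1 - ε) • (Q : 𝔼 n) + ε • (X : 𝔼 n) ∈ posCone C :=
      hC (coe_mem_posCone.2 hQ) (coe_mem_posCone.2 hX) (by linarith [hε.2]) hε.1.le (by ring)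
    have h0 := ne_zero_of_mem_posCone hm
    have h1 := hmin _ ((mem_posCone_iff h0).1 hm)
    have h2 : ‖(1 - ε) • (Q : 𝔼 n) + ε • (X : 𝔼 n)‖ *
        ⟪(P : 𝔼 n), (normalize _ h0 : 𝔼 n)⟫ =
          (1 - ε) * c + ε * ⟪(P : 𝔼 n), (X : 𝔼 n)⟫ := by
      rw [← real_inner_smul_right, norm_smul_normalize, inner_add_right, real_inner_smul_right,
        real_inner_smul_right, hPQ]
    rw [← h2, mul_comm]
    exact mul_le_mul_of_nonneg_left h1 (norm_nonneg _)
  set m := ⟪(P : 𝔼 n), (X : 𝔼 n)⟫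
  set q := ⟪(Q : 𝔼 n), (X : 𝔼 n)⟫ with hq
  set N : ℝ → ℝ := fun ε => ‖(1 - ε) • (Q : 𝔼 n) + ε • (X : 𝔼 n)‖ with hN
  have hNc : Continuous N := by fun_prop
  have hN0 : N 0 = 1 := by simp [hN]
  -- This quotient is `c (N ε - (1 - ε)) / ε`, rationalised.
  have hlim : Tendsto (fun ε : ℝ => c * (ε + 2 * (1 - ε) * q) / (N ε + (1 - ε))) (𝓝[>] 0)
      (𝓝 (c * q)) := by
    have h1 : ContinuousAt (fun ε : ℝ => c * (ε + 2 * (1 - ε) * q) / (N ε + (1 - ε))) 0 := by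
      refine ContinuousAt.div (by fun_prop) (by fun_prop) ?_
      rw [hN0]
      norm_num
    have h2 := h1.tendsto.mono_left (nhdsWithin_le_nhds (s := Ioi 0))
    convert h2 using 2
    rw [hN0]
    ring
  have hle : c * q ≤ m := by
    refine le_of_tendsto hlim ?_
    filter_upwards [Ioo_mem_nhdsGT (zero_lt_one (α := ℝ))] with ε hε
    have hNsq : N ε ^ 2 = (1 - ε) ^ 2 + 2 * (1 - ε) * ε * q + ε ^ 2 := by
      simp only [hN]
      rw [norm_add_sq_real, norm_smul, norm_smul, norm_coe, norm_coe, real_inner_smul_left,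
        real_inner_smul_right, ← hq, Real.norm_eq_abs, Real.norm_eq_abs, mul_one, mul_one, sq_abs,
        sq_abs]
      ring
    have hden : 0 < N ε + (1 - ε) := add_pos_of_nonneg_of_pos (norm_nonneg _) (by linarith [hε.2])
    rw [div_le_iff₀ hden]
    have h3 : c * N ε ≤ (1 - ε) * c + ε * m := hseg ε hε
    have h4 : ε * (c * (ε + 2 * (1 - ε) * q)) ≤ ε * (m * (N ε + (1 - ε))) := by
      have h5 : ε * (c * (ε + 2 * (1 - ε) * q)) = (c * N ε - (1 - ε) * c) * (N ε + (1 - ε)) := by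
        linear_combination (-c) * hNsq
      have h6 := mul_le_mul_of_nonneg_right (sub_le_iff_le_add'.2 h3) hden.le
      linarith
    exact le_of_mul_le_mul_left h4 hε.1
  rw [real_inner_comm, real_inner_comm (Q : 𝔼 n)]
  linarith

theorem add_mem_posCone (hC : SphericallyConvex C) {x y : 𝔼 n} (hx : x ∈ posCone C)
    (hy : y ∈ posCone C) : x + y ∈ posCone C := by
  have h := smul_mem_posCone (two_pos (α := ℝ)) (hC hx hy (a := 1 / 2) (b := 1 / 2)
    (by norm_num) (by norm_num) (by norm_num))
  convert h using 1
  module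

/-- Equality would make `I` farthest from `Q`; the tangent at `I` would be a polar point orthogonal
to an interior point. -/
theorem lt_inner_of_mem_interior (hC : SphericallyConvex C) {I : Sph n} (hI : I ∈ interior C)
    {c s : ℝ} (hs : 0 < s) (hcs : c ^ 2 + s ^ 2 = 1) {Q : Sph n}
    (hQ : ∀ X ∈ C, c ≤ ⟪(Q : 𝔼 n), (X : 𝔼 n)⟫) : c < ⟪(Q : 𝔼 n), (I : 𝔼 n)⟫ := by
  refine (hQ I (interior_subset hI)).lt_of_ne' fun h => ?_
  obtain ⟨Y, hY, hYe⟩ := exists_mem_polar_of_farthest hC (interior_subset hI) hs hcs h hQ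
  have := inner_pos_of_mem_interior hI hY
  rw [hYe, real_inner_smul_right, inner_sub_right, real_inner_smul_right, inner_self_coe,
    real_inner_comm, h] at this
  simp at this

/-! ### Normals as combinations of diametral directions. -/

/-- The unit tangents at `X` pointing towards the points of `C` whose inner product with `X`
is `c = cos τ`, where `s = sin τ`. -/
def diametralDirections (C : Set (Sph n)) (X : Sph n) (c s : ℝ) : Set (𝔼 n) :=
  {y | ∃ Q ∈ C, ⟪(Q : 𝔼 n), (X : 𝔼 n)⟫ = c ∧ y = s⁻¹ • ((Q : 𝔼 n) - c • (X : 𝔼 n))}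

theorem isCompact_diametralDirections (hC : IsClosed C) (X : Sph n) (c s : ℝ) :
    IsCompact (diametralDirections C X c s) := by
  have h1 : IsClosed (C ∩ {Q : Sph n | ⟪(Q : 𝔼 n), (X : 𝔼 n)⟫ = c}) :=
    hC.inter (isClosed_eq (by fun_prop) continuous_const)
  have h2 : Continuous fun Q : Sph n => s⁻¹ • ((Q : 𝔼 n) - c • (X : 𝔼 n)) := by fun_prop
  convert h1.isCompact.image h2 using 1
  ext y
  constructor
  · rintro ⟨Q, hQ, h, rfl⟩
    exact ⟨Q, ⟨hQ, h⟩, rfl⟩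
  · rintro ⟨Q, ⟨hQ, h⟩, rfl⟩
    exact ⟨Q, hQ, h, rfl⟩

/-- The vector `X + εI` is in the cone, while `Y` excludes `X - εV`, so the segment between them
meets the boundary; `Q` is diametral to that crossing. The bound on `ε` keeps the segment off the
origin. -/
theorem exists_near_diametral (hC : IsConvexBody C) {c : ℝ}
    (hfr : ∀ P ∈ frontier C, ∃ Q ∈ C, ⟪(Q : 𝔼 n), (P : 𝔼 n)⟫ = c) {X Y I : Sph n} (hX : X ∈ C)
    (hY : Y ∈ polar C) (hXY : ⟪(X : 𝔼 n), (Y : 𝔼 n)⟫ = 0) (hI : I ∈ C) {V : 𝔼 n}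
    (hVY : 0 < ⟪V, (Y : 𝔼 n)⟫) {ε : ℝ} (hε : 0 < ε) (hεV : ε * (‖V‖ + 1) < 1) :
    ∃ σ ∈ Icc (0 : ℝ) 1, ∃ Q ∈ C,
      ⟪(Q : 𝔼 n), (X : 𝔼 n) + ε • ((1 - σ) • (I : 𝔼 n) - σ • V)⟫ =
        c * ‖(X : 𝔼 n) + ε • ((1 - σ) • (I : 𝔼 n) - σ • V)‖ := by
  have hre : ∀ σ : ℝ, (X : 𝔼 n) + ε • (I : 𝔼 n) +
      σ • ((X : 𝔼 n) - ε • V - ((X : 𝔼 n) + ε • (I : 𝔼 n))) =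
        (X : 𝔼 n) + ε • ((1 - σ) • (I : 𝔼 n) - σ • V) := fun σ => by module
  obtain ⟨σ, hσ, B, hB, hBe⟩ := exists_frontier_on_segment (C := C)
    (a := (X : 𝔼 n) + ε • (I : 𝔼 n)) (b := (X : 𝔼 n) - ε • V) (by
      intro σ hσ h
      rw [hre] at h
      have h1 : ‖(1 - σ) • (I : 𝔼 n) - σ • V‖ ≤ ‖V‖ + 1 := by
        refine (norm_sub_le _ _).trans ?_
        rw [norm_smul, norm_smul, norm_coe, Real.norm_of_nonneg hσ.1,
          Real.norm_of_nonneg (sub_nonneg.2 hσ.2)]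
        have := mul_le_of_le_one_left (norm_nonneg V) hσ.2
        linarith [hσ.1]
      have h2 := norm_coe X
      rw [eq_neg_of_add_eq_zero_left h, norm_neg, norm_smul, Real.norm_of_nonneg hε.le] at h2
      have := mul_le_mul_of_nonneg_left h1 hε.le
      linarith)
    (add_mem_posCone hC.convex (coe_mem_posCone.2 hX)
      (smul_mem_posCone hε (coe_mem_posCone.2 hI))) (by
      intro h
      have := inner_nonneg_of_mem_posCone h hY
      rw [inner_sub_left, hXY, real_inner_smul_left] at this
      have := mul_pos hε hVY
      linarith)
  obtain ⟨Q, hQ, hQB⟩ := hfr B hB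
  refine ⟨σ, hσ, Q, hQ, ?_⟩
  rw [hre] at hBe
  conv_lhs => rw [hBe]
  rw [real_inner_smul_right, hQB, mul_comm]

/-- Every normal of a body of constant diameter at `X` is a nonnegative multiple of a convex
combination of the directions from `X` to its diametral points. -/
theorem exists_smul_mem_convexHull (hC : IsConvexBody C) {c s : ℝ} (hs : 0 < s)
    (hcs : c ^ 2 + s ^ 2 = 1)
    (hle : ∀ P ∈ C, ∀ Q ∈ C, c ≤ ⟪(P : 𝔼 n), (Q : 𝔼 n)⟫)
    (hfr : ∀ P ∈ frontier C, ∃ Q ∈ C, ⟪(Q : 𝔼 n), (P : 𝔼 n)⟫ = c) {X Y : Sph n} (hX : X ∈ C)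
    (hY : Y ∈ polar C) (hXY : ⟪(X : 𝔼 n), (Y : 𝔼 n)⟫ = 0) :
    ∃ t : ℝ, 0 ≤ t ∧ t • (Y : 𝔼 n) ∈ convexHull ℝ (diametralDirections C X c s) := by
  by_contra! hcon
  obtain ⟨V, hV, hVY⟩ := exists_inner_neg_of_ray_disjoint
    (isCompact_diametralDirections hC.isClosed X c s) hcon
  have hVY := hVY (coe_ne_zero Y)
  obtain ⟨I, hI⟩ := hC.nonempty_interior
  let U : ℝ → 𝔼 n := fun σ => (1 - σ) • (I : 𝔼 n) - σ • V
  have hU : Continuous U := by fun_prop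
  let ε : ℕ → ℝ := fun k => 1 / ((k : ℝ) + 1) * (2 * (‖V‖ + 1))⁻¹
  have hV1 : 0 < ‖V‖ + 1 := by positivity
  have hε : ∀ k, 0 < ε k := fun k => by positivity
  have hε1 : ∀ k, ε k * (‖V‖ + 1) < 1 := by
    intro k
    have h1 : ε k * (‖V‖ + 1) = 1 / ((k : ℝ) + 1) * (1 / 2) := by
      simp only [ε]
      field_simp
    have h2 : 1 / ((k : ℝ) + 1) ≤ 1 := by
      rw [div_le_one (by positivity)]
      linarith [k.cast_nonneg (α := ℝ)]
    linarith
  have hε0 : Tendsto ε atTop (𝓝 0) := by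
    have h := (tendsto_one_div_add_atTop_nhds_zero_nat (𝕜 := ℝ)).mul_const (2 * (‖V‖ + 1))⁻¹
    rwa [zero_mul] at h
  choose σ hσ Q hQ hQe using fun k => exists_near_diametral hC hfr hX hY hXY
    (interior_subset hI) hVY (hε k) (hε1 k)
  obtain ⟨⟨σ', Q'⟩, ⟨hσ', hQ'⟩, φ, hφ, hlim⟩ :=
    (isCompact_Icc.prod hC.isClosed.isCompact).tendsto_subseq
      (x := fun k => (σ k, Q k)) fun k => ⟨hσ k, hQ k⟩
  have hσl : Tendsto (fun k => σ (φ k)) atTop (𝓝 σ') := (continuous_fst.tendsto _).comp hlim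
  have hQl : Tendsto (fun k => (Q (φ k) : 𝔼 n)) atTop (𝓝 (Q' : 𝔼 n)) :=
    ((continuous_subtype_val.comp continuous_snd).tendsto _).comp hlim
  have hεl : Tendsto (fun k => ε (φ k)) atTop (𝓝 0) := hε0.comp hφ.tendsto_atTop
  have hUl : Tendsto (fun k => U (σ (φ k))) atTop (𝓝 (U σ')) := (hU.tendsto _).comp hσl
  have hBl : Tendsto (fun k => (X : 𝔼 n) + ε (φ k) • U (σ (φ k))) atTop (𝓝 (X : 𝔼 n)) := by
    simpa using (hεl.smul hUl).const_add (X : 𝔼 n)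
  have hQX : ⟪(Q' : 𝔼 n), (X : 𝔼 n)⟫ = c := by
    have h1 := hQl.inner hBl (𝕜 := ℝ)
    have h2 := hBl.norm.const_mul c
    rw [norm_coe, mul_one] at h2
    exact tendsto_nhds_unique (h1.congr fun k => hQe (φ k)) h2
  -- First-order part of `hQe`: since `Q · X ≥ c`, one has `ε (Q · U) ≤ c (N - 1)`, where `N` is the
  -- norm of `X + εU`; multiply by `N + 1` and pass to the limit.
  have hQU : ⟪(Q' : 𝔼 n), U σ'⟫ ≤ c * ⟪(X : 𝔼 n), U σ'⟫ := by
    have h1 : Tendsto (fun k => c * (2 * ⟪(X : 𝔼 n), U (σ (φ k))⟫ +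
        ε (φ k) * ‖U (σ (φ k))‖ ^ 2) / (‖(X : 𝔼 n) + ε (φ k) • U (σ (φ k))‖ + 1)) atTop
        (𝓝 (c * ⟪(X : 𝔼 n), U σ'⟫)) := by
      have h2 := (((((tendsto_const_nhds (x := (X : 𝔼 n))).inner hUl (𝕜 := ℝ)).const_mul 2).add
        (hεl.mul (hUl.norm.pow 2))).const_mul c).div (hBl.norm.add_const 1)
        (by rw [norm_coe]; norm_num)
      rw [norm_coe] at h2
      have h3 : c * (2 * ⟪(X : 𝔼 n), U σ'⟫ + 0 * ‖U σ'‖ ^ 2) / (1 + 1) =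
          c * ⟪(X : 𝔼 n), U σ'⟫ := by ring
      rw [h3] at h2
      exact h2
    refine le_of_tendsto_of_tendsto' (hQl.inner hUl) h1 fun k => ?_
    have hq := hQe (φ k)
    change ⟪(Q (φ k) : 𝔼 n), (X : 𝔼 n) + ε (φ k) • U (σ (φ k))⟫ =
      c * ‖(X : 𝔼 n) + ε (φ k) • U (σ (φ k))‖ at hq
    have hN : ‖(X : 𝔼 n) + ε (φ k) • U (σ (φ k))‖ ^ 2 =
        1 + 2 * (ε (φ k) * ⟪(X : 𝔼 n), U (σ (φ k))⟫) + (ε (φ k) * ‖U (σ (φ k))‖) ^ 2 := by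
      rw [norm_add_sq_real, real_inner_smul_right, norm_smul, norm_coe,
        Real.norm_of_nonneg (hε _).le]
      ring
    have hN0 := norm_nonneg ((X : 𝔼 n) + ε (φ k) • U (σ (φ k)))
    rw [inner_add_right, real_inner_smul_right] at hq
    have hc := hle _ (hQ (φ k)) X hX
    generalize ‖(X : 𝔼 n) + ε (φ k) • U (σ (φ k))‖ = N at *
    rw [le_div_iff₀ (by linarith)]
    refine le_of_mul_le_mul_left ?_ (hε (φ k))
    have h3 : ε (φ k) * ⟪(Q (φ k) : 𝔼 n), U (σ (φ k))⟫ ≤ c * (N - 1) := by linarith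
    have h4 := mul_le_mul_of_nonneg_right h3 (by linarith : 0 ≤ N + 1)
    have h5 : c * (N - 1) * (N + 1) = ε (φ k) * (c * (2 * ⟪(X : 𝔼 n), U (σ (φ k))⟫ +
        ε (φ k) * ‖U (σ (φ k))‖ ^ 2)) := by
      linear_combination c * hN
    linarith
  -- The direction `Y'` from `X` to `Q'` has `Y' · U ≤ 0`, yet `I · Y' > 0` and `V · Y' < 0` make it
  -- positive.
  obtain ⟨Y', hY', hYe⟩ := exists_mem_polar_of_farthest hC.convex hX hs hcs hQX (hle Q' hQ')
  have hVY' : ⟪V, (Y' : 𝔼 n)⟫ < 0 := hV _ ⟨Q', hQ', hQX, hYe⟩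
  have hIY' := inner_pos_of_mem_interior hI hY'
  have hUY' : ⟪U σ', (Y' : 𝔼 n)⟫ ≤ 0 := by
    rw [hYe, real_inner_smul_right, inner_sub_right, real_inner_smul_right, real_inner_comm,
      real_inner_comm (X : 𝔼 n)]
    exact mul_nonpos_of_nonneg_of_nonpos (inv_pos.2 hs).le (by linarith)
  simp only [U] at hUY'
  rw [inner_sub_left, real_inner_smul_left, real_inner_smul_left] at hUY'
  have hσ' : σ' ∈ Icc (0 : ℝ) 1 := hσ'
  rcases hσ'.1.eq_or_lt with h | h
  · rw [← h] at hUY'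
    linarith
  · have h1 := mul_neg_of_pos_of_neg h hVY'
    have h2 := mul_nonneg (sub_nonneg.2 hσ'.2) hIY'.le
    linarith

/-! ### Completeness and points along normals. -/

/-- If a unit vector has inner product at least `cos τ ≥ 0` with every point of a body of
constant diameter `τ`, then it belongs to the body. -/
theorem mem_of_forall_le_inner (hC : IsConvexBody C) {c s : ℝ} (hs : 0 < s) (hc : 0 ≤ c)
    (hcs : c ^ 2 + s ^ 2 = 1)
    (hle : ∀ P ∈ C, ∀ Q ∈ C, c ≤ ⟪(P : 𝔼 n), (Q : 𝔼 n)⟫)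
    (hfr : ∀ P ∈ frontier C, ∃ Q ∈ C, ⟪(Q : 𝔼 n), (P : 𝔼 n)⟫ = c) {W Y : Sph n}
    (hY : Y ∈ polar C) (hWY : 0 < ⟪(W : 𝔼 n), (Y : 𝔼 n)⟫)
    (hW : ∀ Q ∈ C, c ≤ ⟪(Q : 𝔼 n), (W : 𝔼 n)⟫) : W ∈ C := by
  by_contra hWC
  obtain ⟨I, hI⟩ := hC.nonempty_interior
  have hIY := inner_pos_of_mem_interior hI hY
  obtain ⟨σ, hσ, B, hB, hBe⟩ := exists_frontier_on_segment (C := C) (a := (I : 𝔼 n))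
    (b := (W : 𝔼 n)) (by
      intro σ hσ h
      have h1 : ⟪(I : 𝔼 n) + σ • ((W : 𝔼 n) - (I : 𝔼 n)), (Y : 𝔼 n)⟫ = 0 := by
        rw [h, inner_zero_left]
      rw [inner_add_left, real_inner_smul_left, inner_sub_left] at h1
      rcases hσ.1.eq_or_lt with h2 | h2
      · rw [← h2] at h1
        linarith
      · have h3 := mul_pos h2 hWY
        have h4 := mul_nonneg (sub_nonneg.2 hσ.2) hIY.le
        linarith)
    (coe_mem_posCone.2 (interior_subset hI)) (fun h => hWC (coe_mem_posCone.1 h))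
  obtain ⟨Q, hQ, hQB⟩ := hfr B hB
  have hnorm : ‖(I : 𝔼 n) + σ • ((W : 𝔼 n) - (I : 𝔼 n))‖ ≤ 1 := by
    have h1 : (I : 𝔼 n) + σ • ((W : 𝔼 n) - (I : 𝔼 n)) = (1 - σ) • (I : 𝔼 n) + σ • (W : 𝔼 n) := by
      module
    rw [h1]
    refine (norm_add_le _ _).trans ?_
    rw [norm_smul, norm_smul, norm_coe, norm_coe, Real.norm_of_nonneg hσ.1,
      Real.norm_of_nonneg (sub_nonneg.2 hσ.2)]
    linarith
  -- Here `c ≥ 0` matters: a chord point has norm at most `1`. But `Q · I > c` and `Q · W ≥ c` push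
  -- the product above `c` unless the crossing is `W` itself.
  have hinner : ⟪(Q : 𝔼 n), (I : 𝔼 n) + σ • ((W : 𝔼 n) - (I : 𝔼 n))⟫ ≤ c := by
    rw [hBe, real_inner_smul_right, hQB]
    exact mul_le_of_le_one_left hc hnorm
  rw [inner_add_right, real_inner_smul_right, inner_sub_right] at hinner
  have hIc := lt_inner_of_mem_interior hC.convex hI hs hcs (hle Q hQ)
  have hWc := hW Q hQ
  rcases hσ.2.eq_or_lt with h | h
  · rw [h] at hBe
    rw [one_smul, add_sub_cancel] at hBe
    rw [norm_coe, one_smul] at hBe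
    exact hWC (Subtype.ext hBe ▸ hC.isClosed.frontier_subset hB)
  · have h1 := mul_pos (sub_pos.2 h) (sub_pos.2 hIc)
    have h2 := mul_nonneg hσ.1 (sub_nonneg.2 hWc)
    linarith

theorem norm_sq_smul_add_smul {X Y : Sph n} (hXY : ⟪(X : 𝔼 n), (Y : 𝔼 n)⟫ = 0) (a b : ℝ) :
    ‖a • (X : 𝔼 n) + b • (Y : 𝔼 n)‖ ^ 2 = a ^ 2 + b ^ 2 := by
  rw [norm_add_sq_real, real_inner_smul_left, real_inner_smul_right, hXY, norm_smul, norm_smul,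
    norm_coe, norm_coe, Real.norm_eq_abs, Real.norm_eq_abs, mul_one, mul_one, sq_abs, sq_abs]
  ring

/-- In a body of constant diameter `τ`, the point at distance `τ` from a boundary point `X` along
any inner normal `Y` at `X` belongs to the body. -/
theorem exists_mem_along_normal (hC : IsConvexBody C) {c s : ℝ} (hs : 0 < s)
    (hcs : c ^ 2 + s ^ 2 = 1)
    (hle : ∀ P ∈ C, ∀ Q ∈ C, c ≤ ⟪(P : 𝔼 n), (Q : 𝔼 n)⟫)
    (hfr : ∀ P ∈ frontier C, ∃ Q ∈ C, ⟪(Q : 𝔼 n), (P : 𝔼 n)⟫ = c) {X Y : Sph n} (hX : X ∈ C)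
    (hY : Y ∈ polar C) (hXY : ⟪(X : 𝔼 n), (Y : 𝔼 n)⟫ = 0) :
    ∃ P ∈ C, (P : 𝔼 n) = c • (X : 𝔼 n) + s • (Y : 𝔼 n) := by
  obtain ⟨t, ht, hmem⟩ := exists_smul_mem_convexHull hC hs hcs hle hfr hX hY hXY
  have hback : ∀ Q : 𝔼 n, c • (X : 𝔼 n) + s • s⁻¹ • (Q - c • (X : 𝔼 n)) = Q := fun Q => by
    rw [smul_inv_smul₀ hs.ne', add_sub_cancel]
  have ht1 : t ≤ 1 := by
    have h1 : convexHull ℝ (diametralDirections C X c s) ⊆ Metric.closedBall 0 1 := by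
      refine convexHull_min ?_ (convex_closedBall _ _)
      rintro _ ⟨Q, hQ, hQX, rfl⟩
      obtain ⟨Y', -, hYe⟩ := exists_mem_polar_of_farthest hC.convex hX hs hcs hQX (hle Q hQ)
      rw [← hYe, mem_closedBall_zero_iff, norm_coe]
    have h2 := h1 hmem
    rwa [mem_closedBall_zero_iff, norm_smul, norm_coe, mul_one, Real.norm_of_nonneg ht] at h2
  have hWn : ‖c • (X : 𝔼 n) + s • (Y : 𝔼 n)‖ = 1 := by
    have := norm_sq_smul_add_smul hXY c s
    rw [hcs] at this
    exact (pow_eq_one_iff_of_nonneg (norm_nonneg _) two_ne_zero).1 this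
  refine ⟨⟨c • (X : 𝔼 n) + s • (Y : 𝔼 n), by simpa using hWn⟩, ?_, rfl⟩
  rcases lt_or_ge c 0 with hc | hc
  · have h1 : convexHull ℝ (diametralDirections C X c s) ⊆
        {h | c • (X : 𝔼 n) + s • h ∈ posCone C} := by
      refine convexHull_min ?_ ?_
      · rintro _ ⟨Q, hQ, -, rfl⟩
        change _ ∈ posCone C
        rw [hback]
        exact coe_mem_posCone.2 hQ
      · intro x hx y hy a b ha hb hab
        have h2 := hC.convex hx hy ha hb hab
        change _ ∈ posCone C
        convert h2 using 1
        rw [← eq_sub_iff_add_eq'] at hab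
        rw [hab]
        module
    have h2 : c • (X : 𝔼 n) + s • t • (Y : 𝔼 n) ∈ posCone C := h1 hmem
    -- From `r (X · u) = c < 0` and `X · u ≥ c` comes `r ≥ 1`; as `r² = c² + s²t²`, this forces `t ≥
    -- 1`.
    have ht' : t = 1 := by
      obtain ⟨r, hr, u, hu, hre⟩ := h2
      rw [smul_smul] at hre
      have h3 := norm_sq_smul_add_smul hXY c (s * t)
      rw [hre, norm_smul, norm_coe, Real.norm_of_nonneg hr.le] at h3
      have h4 : ⟪(X : 𝔼 n), c • (X : 𝔼 n) + (s * t) • (Y : 𝔼 n)⟫ = c := by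
        rw [inner_add_right, real_inner_smul_right, real_inner_smul_right, hXY, inner_self_coe]
        ring
      rw [hre, real_inner_smul_right] at h4
      have h5 := mul_le_mul_of_nonneg_left (hle X hX u hu) hr.le
      have h6 : 1 ≤ r := by
        by_contra! h
        have := mul_neg_of_pos_of_neg (sub_pos.2 h) hc
        linarith
      have h7 : s ^ 2 * 1 ≤ s ^ 2 * t ^ 2 := by nlinarith
      have h8 := le_of_mul_le_mul_left h7 (by positivity)
      nlinarith
    rw [ht', one_smul] at h2
    exact coe_mem_posCone.1 h2
  -- The bound `c ≤ Q · (cX + stY)` holds by convexity, and raising `t` to `1` only helps since `Q ·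
  -- Y ≥ 0`.
  · refine mem_of_forall_le_inner hC hs hc hcs hle hfr hY ?_ fun Q hQ => ?_
    · change 0 < ⟪c • (X : 𝔼 n) + s • (Y : 𝔼 n), (Y : 𝔼 n)⟫
      rw [inner_add_left, real_inner_smul_left, real_inner_smul_left, hXY, inner_self_coe]
      simpa using hs
    · change c ≤ ⟪(Q : 𝔼 n), c • (X : 𝔼 n) + s • (Y : 𝔼 n)⟫
      have h1 : convexHull ℝ (diametralDirections C X c s) ⊆
          {h | c ≤ ⟪(Q : 𝔼 n), c • (X : 𝔼 n) + s • h⟫} := by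
        refine convexHull_min ?_ ?_
        · rintro _ ⟨P, hP, -, rfl⟩
          change c ≤ _
          rw [hback]
          exact hle Q hQ P hP
        · intro x hx y hy a b ha hb hab
          change c ≤ _
          have hx' : c ≤ ⟪(Q : 𝔼 n), c • (X : 𝔼 n) + s • x⟫ := hx
          have hy' : c ≤ ⟪(Q : 𝔼 n), c • (X : 𝔼 n) + s • y⟫ := hy
          simp only [inner_add_right, real_inner_smul_right] at hx' hy' ⊢
          have hx2 := mul_le_mul_of_nonneg_left hx' ha
          have hy2 := mul_le_mul_of_nonneg_left hy' hb
          rw [← eq_sub_iff_add_eq'] at hab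
          rw [hab] at hy2 ⊢
          linarith
      have h2 : c ≤ ⟪(Q : 𝔼 n), c • (X : 𝔼 n) + s • t • (Y : 𝔼 n)⟫ := h1 hmem
      refine h2.trans ?_
      simp only [inner_add_right, real_inner_smul_right]
      have := mul_le_of_le_one_left (mem_polar.1 hY Q hQ) ht1
      have := mul_le_mul_of_nonneg_left this hs.le
      linarith

/-! ### Constant diameter passes to the polar. -/

theorem IsOfConstantDiameter.polar {τ : ℝ} (hτ_pos : 0 < τ) (hτ_lt : τ < Real.pi)
    (h : IsOfConstantDiameter C τ) : IsOfConstantDiameter (polar C) (Real.pi - τ) := by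
  have hC := h.isConvexBody
  have hCp := hC.polar
  have hs : 0 < Real.sin τ := Real.sin_pos_of_pos_of_lt_pi hτ_pos hτ_lt
  have hcs : Real.cos τ ^ 2 + Real.sin τ ^ 2 = 1 := Real.cos_sq_add_sin_sq τ
  have hinner : ∀ P Q : Sph n, ⟪(P : 𝔼 n), (Q : 𝔼 n)⟫ ∈ Icc (-1 : ℝ) 1 := by
    intro P Q
    have := abs_real_inner_le_norm (P : 𝔼 n) (Q : 𝔼 n)
    rw [norm_coe, norm_coe, mul_one] at this
    exact abs_le.1 this
  have hcos : ∀ P Q : Sph n, Real.cos (sdist P Q) = ⟪(P : 𝔼 n), (Q : 𝔼 n)⟫ := fun P Q =>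
    Real.cos_arccos (hinner P Q).1 (hinner P Q).2
  have hle : ∀ P ∈ C, ∀ Q ∈ C, Real.cos τ ≤ ⟪(P : 𝔼 n), (Q : 𝔼 n)⟫ := by
    intro P hP Q hQ
    rw [← hcos]
    exact Real.cos_le_cos_of_nonneg_of_le_pi (Real.arccos_nonneg _) hτ_lt.le
      (h.hasDiameter.2 ⟨P, hP, Q, hQ, rfl⟩)
  have hfr : ∀ P ∈ frontier C, ∃ Q ∈ C, ⟪(Q : 𝔼 n), (P : 𝔼 n)⟫ = Real.cos τ := by
    intro P hP
    obtain ⟨Q, hQ, hPQ⟩ := h.exists_sdist_eq P hP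
    exact ⟨Q, hQ, by rw [real_inner_comm, ← hcos, hPQ]⟩
  have hdist : ∀ Y Z : Sph n, ⟪(Y : 𝔼 n), (Z : 𝔼 n)⟫ = -Real.cos τ →
      sdist Y Z = Real.pi - τ := by
    intro Y Z hYZ
    rw [sdist, hYZ, Real.arccos_neg, Real.arccos_cos hτ_pos.le hτ_lt.le]
  have hex : ∀ X ∈ C, ∀ Y ∈ SphericalBody.polar C, ⟪(X : 𝔼 n), (Y : 𝔼 n)⟫ = 0 →
      ∃ Z ∈ SphericalBody.polar C, sdist Y Z = Real.pi - τ := by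
    intro X hX Y hY hXY
    obtain ⟨P, hP, hPe⟩ := exists_mem_along_normal hC hs hcs hle hfr hX hY hXY
    have hXP : ⟪(X : 𝔼 n), (P : 𝔼 n)⟫ = Real.cos τ := by
      rw [hPe, inner_add_right, real_inner_smul_right, real_inner_smul_right, hXY, inner_self_coe]
      ring
    obtain ⟨Z, hZ, hZe⟩ := exists_mem_polar_of_farthest hC.convex hP hs hcs hXP (hle X hX)
    refine ⟨Z, hZ, hdist Y Z ?_⟩
    rw [hZe, hPe, real_inner_smul_right, inner_sub_right, real_inner_smul_right, inner_add_right,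
      real_inner_smul_right, real_inner_smul_right, inner_self_coe, real_inner_comm, hXY]
    field_simp
    ring
  refine ⟨hCp, ⟨?_, ?_⟩, ?_⟩
  · obtain ⟨P, hP, Q, hQ, hPQ⟩ := h.hasDiameter.1
    have hPQ' : ⟪(P : 𝔼 n), (Q : 𝔼 n)⟫ = Real.cos τ := by rw [← hcos, ← hPQ]
    obtain ⟨Y, hY, hYe⟩ := exists_mem_polar_of_farthest hC.convex hQ hs hcs hPQ' (hle P hP)
    obtain ⟨Z, hZ, hYZ⟩ := hex Q hQ Y hY (by
      rw [hYe, real_inner_smul_right, inner_sub_right, real_inner_smul_right, inner_self_coe,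
        real_inner_comm, hPQ']
      ring)
    exact ⟨Y, hY, Z, hZ, hYZ.symm⟩
  · obtain ⟨Y₀, hY₀⟩ := hCp.nonempty_interior
    have hcont : Continuous fun q : Sph n × Sph n => sdist q.1 q.2 :=
      Real.continuous_arccos.comp (by fun_prop)
    obtain ⟨⟨Y, Z⟩, ⟨hY, hZ⟩, hmax⟩ :=
      (hCp.isClosed.isCompact.prod hCp.isClosed.isCompact).exists_isMaxOn
        ⟨(Y₀, Y₀), interior_subset hY₀, interior_subset hY₀⟩ hcont.continuousOn
    rintro _ ⟨Y₁, hY₁, Z₁, hZ₁, rfl⟩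
    refine (hmax (a := (Y₁, Z₁)) ⟨hY₁, hZ₁⟩).trans ?_
    change sdist Y Z ≤ Real.pi - τ
    by_contra! hgt
    set δ := sdist Y Z with hδ
    obtain ⟨I, hI⟩ := hC.nonempty_interior
    -- Antipodal `Y, Z` cannot both be strictly positive on an interior point of `C`.
    have hδpi : δ < Real.pi := by
      refine (Real.arccos_le_pi _).lt_of_ne fun he => ?_
      have h1 : ⟪(Y : 𝔼 n), (Z : 𝔼 n)⟫ = -1 := by
        rw [← hcos, ← hδ, show δ = Real.pi from he, Real.cos_pi]
      have h2 : (Y : 𝔼 n) + (Z : 𝔼 n) = 0 := by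
        have h3 : ‖(Y : 𝔼 n) + (Z : 𝔼 n)‖ ^ 2 = 0 := by
          rw [norm_add_sq_real, h1, norm_coe, norm_coe]
          norm_num
        exact norm_eq_zero.1 (pow_eq_zero_iff two_ne_zero |>.1 h3)
      have h4 : ⟪(I : 𝔼 n), (Y : 𝔼 n) + (Z : 𝔼 n)⟫ = 0 := by rw [h2, inner_zero_right]
      rw [inner_add_right] at h4
      linarith [inner_pos_of_mem_interior hI hY, inner_pos_of_mem_interior hI hZ]
    have hδ0 : 0 < δ := by linarith
    have hsδ := Real.sin_pos_of_pos_of_lt_pi hδ0 hδpi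
    have hZY : ⟪(Z : 𝔼 n), (Y : 𝔼 n)⟫ = Real.cos δ := by rw [real_inner_comm, hδ, hcos]
    obtain ⟨X, hX, hXe⟩ := exists_mem_polar_of_farthest hCp.convex hY hsδ
      (Real.cos_sq_add_sin_sq δ) hZY (by
        intro W hW
        rw [← hcos]
        refine Real.cos_le_cos_of_nonneg_of_le_pi (Real.arccos_nonneg _) hδpi.le ?_
        exact hmax (a := (Z, W)) ⟨hZ, hW⟩)
    rw [polar_polar hC] at hX
    have hXY : ⟪(X : 𝔼 n), (Y : 𝔼 n)⟫ = 0 := by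
      rw [hXe, real_inner_smul_left, inner_sub_left, real_inner_smul_left, inner_self_coe, hZY]
      ring
    obtain ⟨P, hP, hPe⟩ := exists_mem_along_normal hC hs hcs hle hfr hX hY hXY
    have hPZ := mem_polar.1 hZ P hP
    have hXZ : ⟪(X : 𝔼 n), (Z : 𝔼 n)⟫ = Real.sin δ := by
      rw [hXe, real_inner_smul_left, inner_sub_left, real_inner_smul_left, inner_self_coe,
        real_inner_comm, hZY]
      field_simp
      linear_combination -Real.cos_sq_add_sin_sq δ
    rw [hPe, inner_add_left, real_inner_smul_left, real_inner_smul_left, hXZ, real_inner_comm,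
      hZY] at hPZ
    -- `π < τ + δ < 2π`, whereas `hPZ` says that this sine is nonnegative.
    have hsin : Real.sin (τ + δ) < 0 := by
      have := Real.sin_pos_of_pos_of_lt_pi (x := τ + δ - Real.pi) (by linarith) (by linarith)
      rw [Real.sin_sub_pi] at this
      linarith
    rw [Real.sin_add] at hsin
    linarith
  · intro Y hY
    have hYC := hCp.isClosed.frontier_subset hY
    obtain ⟨X, hX, hXY⟩ := exists_inner_eq_zero_of_mem_frontier_polar hC.isClosed hY hYC
    exact hex X hX Y hYC hXY

end SphericalBody

theorem corollary2p4 (n : ℕ) (C : Set (SphericalBody.Sph n)) (hC : SphericalBody.IsConvexBody C)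
    (τ : ℝ) (hτ_pos : 0 < τ) (hτ_lt : τ < Real.pi) :
    SphericalBody.IsOfConstantDiameter C τ ↔
      SphericalBody.IsOfConstantDiameter (SphericalBody.polar C) (Real.pi - τ) := by
  refine ⟨fun h => h.polar hτ_pos hτ_lt, fun h => ?_⟩
  have h2 := h.polar (by linarith) (by linarith)
  rwa [SphericalBody.polar_polar hC, sub_sub_cancel] at h2
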